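/- **Conventions.** For $n\ge 1$ a plane permutation on $[n]=\{1,\dots,n\}$ is a pair $\mathfrak p=(s,\pi)$ where $s$ is an $n$-cycle on $[n]$ (for $n=1$, the identity) and $\pi$, called the vertical, is an arbitrary permutation of $[n]$. Its diagonal is the permutation $D_{\mathfrak p}=s\circ\pi^{-1}$. For partitions $\lambda,\mu\vdash n$ and $m\le n$ let $p^{\lambda}_{m,\mu}$ be the number of plane permutations on $[n]$ whose diagonal has cycle type $\lambda$, whose vertical has cycle type $\mu$, and for which the elements of $[m]$ lie in pairwise distinct cycles of the vertical. Let $\ell(\cdot)$ denote the number of parts, write $\lambda=1^{a_1}2^{a_2}\cdots n^{a_n}$ (so $a_i$ is the number of parts of $\lambda$ equal to $i$), let $\ell_1^{\mu}$ be the number of parts of $\mu$, counted with multiplicity, that are larger than $1$, and put $\bar\delta_{1r}=0$ if $r=1$ and $\bar\delta_{1r}=1$ otherwise. **Theorem.** Let $\lambda,\mu\vdash n$ with $\ell(\mu)=d$, $\ell(\lambda)=t$ and $d+t=n+1$, and let $1\le m\le n$. If $m\le d$, then $$ p^{\lambda}_{m,\mu}=\frac{(t-1)!\,(d-1)!\,(n-m)!}{\left(\prod_{i=1}^{n}a_i!\right)(d-m)!}\;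 \sum_{\bigl(r,\,(r_1,\dots,r_b),\,(q_1,\dots,q_c)\bigr)}\binom{d-m}{\ell_1^{\mu}-b-\bar\delta_{1r}}\binom{m-1}{b}\,r\prod_{j=1}^{b}(r_j+1), $$ where the sum is over all distinct triples consisting of an integer $r>0$ that is a part of $\mu$, a tuple $(r_1,\dots,r_b)$ with $b\ge 0$, and a tuple $(q_1,\dots,q_c)$ with $c=\ell_1^{\mu}-b-\bar\delta_{1r}\ge 0$, such that, as multisets, $$ \{r\}\cup\{r_1,\dots,r_b\}\cup\{q_1,\dots,q_c\}=\{r\}\cup\bigl(\{\mu_i-1:\mu_i>1\}\setminus\{r-1\}\bigr). $$ Here the tuples have natural-number entries, $\cup$ adds multiplicities, and $\setminus\{r-1\}$ removes one copy of $r-1$ if there is one (so it removes nothing when $r=1$). If $d<m\le n$, then $p^{\lambda}_{m,\mu}=0$. -/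

import Mathlib

open scoped Nat BigOperators

/-- A plane permutation on `[n]`, modelled as `Fin n` (so that the paper's `i` is the element of
value `i - 1`): a pair `(s, π)` of an `n`-cycle `s` and an arbitrary permutation `π`.
A permutation is an `n`-cycle when it has a single orbit on `[n]`; in particular the identity
is a `1`-cycle when `n = 1`. -/
structure PlanePermutation (n : ℕ) where
  /-- the upper horizontal -/
  horizontal : Equiv.Perm (Fin n)
  /-- the vertical -/
  vertical : Equiv.Perm (Fin n)
  isLongCycle : horizontal.IsCycleOn Set.univ

/-- The diagonal of a plane permutation `(s, π)`: the permutation sending `π (s_{i-1})` to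
`s_i` (cyclically), that is `s ∘ π⁻¹`. -/
def PlanePermutation.diagonal {n : ℕ} (p : PlanePermutation n) : Equiv.Perm (Fin n) :=
  p.horizontal * p.vertical⁻¹

theorem PlanePermutation.diagonal_vertical {n : ℕ} (p : PlanePermutation n) (x : Fin n) :
    p.diagonal (p.vertical x) = p.horizontal x := by
  simp [PlanePermutation.diagonal]

/-- The permutation `σ` of `[n]` has cycle type `η ⊢ n` (fixed points are parts `1`). -/
def HasCycleType {n : ℕ} (σ : Equiv.Perm (Fin n)) (η : n.Partition) : Prop :=
  σ.partition.parts = η.parts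

/-- The elements of `[m]` (the first `m` elements of `[n]`) lie in pairwise distinct
cycles of `σ`. -/
def Separates {n : ℕ} (m : ℕ) (σ : Equiv.Perm (Fin n)) : Prop :=
  ∀ x y : Fin n, (x : ℕ) < m → (y : ℕ) < m → x ≠ y → ¬ σ.SameCycle x y

/-- The plane permutations on `[n]` with diagonal of cycle type `lam` and vertical of cycle
type `mu` such that the elements of `[m]` lie in distinct cycles of the vertical. -/
def separatedPlanePermutations {n : ℕ} (m : ℕ) (lam mu : n.Partition) :
    Set (PlanePermutation n) :=
  {p | HasCycleType p.diagonal lam ∧ HasCycleType p.vertical mu ∧ Separates m p.vertical}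

/-- The number `p^λ_{m,μ}`. -/
noncomputable def numSeparated {n : ℕ} (m : ℕ) (lam mu : n.Partition) : ℕ :=
  (separatedPlanePermutations m lam mu).ncard

/-- The number of parts of a partition. -/
def numParts {n : ℕ} (mu : n.Partition) : ℕ := mu.parts.card

/-- The number of parts (with multiplicity) larger than `1`. -/
def numBigParts {n : ℕ} (mu : n.Partition) : ℕ := (mu.parts.filter (1 < ·)).card

/-- `0` if `r = 1`, and `1` otherwise. -/
def deltaBar (r : ℕ) : ℕ := if r = 1 then 0 else 1

/-- The multiset `{μ_i - 1 : μ_i > 1}`. -/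
def decrementedParts {n : ℕ} (mu : n.Partition) : Multiset ℕ :=
  (mu.parts.filter (1 < ·)).map (· - 1)

/-- The index set of the sum: triples `(r, (r_1, …, r_b), (q_1, …, q_c))` where `r` is a positive
part of `μ`, `b + c + δ̄_{1r}` is the number of parts of `μ` larger than `1`, and
`{r} ∪ {r_j} ∪ {q_j} = {r} ∪ ({μ_i - 1 : μ_i > 1} \ {r - 1})` as multisets. -/
def tupleIndexSet {n : ℕ} (mu : n.Partition) : Set (ℕ × List ℕ × List ℕ) :=
  {x | 0 < x.1 ∧ x.1 ∈ mu.parts ∧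
    x.2.1.length + x.2.2.length + deltaBar x.1 = numBigParts mu ∧
    ({x.1} + (x.2.1 : Multiset ℕ) + (x.2.2 : Multiset ℕ) : Multiset ℕ) =
      {x.1} + (decrementedParts mu - {x.1 - 1})}

theorem tupleIndexSet_finite {n : ℕ} (mu : n.Partition) : (tupleIndexSet mu).Finite := by
  classical
  have hL : {l : List ℕ | (l : Multiset ℕ) ≤ decrementedParts mu}.Finite := by
    have : {l : List ℕ | (l : Multiset ℕ) ≤ decrementedParts mu} ⊆
        ((decrementedParts mu).powerset.toFinset.biUnion fun t => t.lists.toFinset :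
          Finset (List ℕ)) := by
      intro l hl
      simp only [Finset.coe_biUnion, Set.mem_iUnion]
      refine ⟨(l : Multiset ℕ), by simpa using hl, ?_⟩
      simp
    exact (Finset.finite_toSet _).subset this
  refine ((mu.parts.toFinset.finite_toSet).prod (hL.prod hL)).subset ?_
  rintro ⟨r, rs, qs⟩ ⟨-, hr, -, h⟩
  simp only [add_assoc] at h
  have h' := add_left_cancel h
  have hle : (rs : Multiset ℕ) + (qs : Multiset ℕ) ≤ decrementedParts mu :=
    h' ▸ Multiset.sub_le_self _ _
  exact ⟨by simpa using hr, (Multiset.le_add_right _ _).trans hle,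
    (Multiset.le_add_left _ _).trans hle⟩

/-! Sending a plane permutation to the pair (diagonal, vertical) turns the problem into counting
pairs (α, β) of prescribed cycle types whose product is an n-cycle, with [m] separated by β.
Simultaneous conjugation makes all injective m-sequences of points equivalent. Double counting pairs
(factorization, separated sequence) therefore gives `descFactorial_mul_numSeparated`: n(n-1)⋯(n-m+1)
times the wanted number equals the number of all factorizations times the number of m-sequences
meeting distinct cycles of a permutation of type μ.

The first factor is the Goulden–Jackson formula `card_cycleFactorizations`, by induction on n. Since
d + t = n + 1, one of the two types has a part 1. By symmetry β may be taken to have a fixed point,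
and by conjugation this point may be taken to be 0. Deleting 0 from both factors leaves a
factorization of a shorter long cycle in which one cycle of α has lost a point.

The second factor, `injectiveWeight`, is up to factorials a sum over the distinct arrangements w of
the parts of μ of the product of the first m letters (`countFactorial_mul_wordSum`). The first
letter of w is r. The next m - 1 letters and the last d - m letters, with ones dropped and other
letters decremented, are the two tuples of the statement. The binomial coefficients count the ways
to put the ones back (`wordSum_eq_sum_splitWords`, `sum_tupleIndexSet_eq_wordSum`). -/

open Equiv.Perm (decomposeFin)

/-! ### Cycle types read off from labellings of the cycles -/

/-- `f` labels the elements so that two of them get the same label exactly when they lie in the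
same cycle of `σ`. -/
def IsCycleLabelling {X ι : Type*} (σ : Equiv.Perm X) (f : X → ι) : Prop :=
  ∀ x y, σ.SameCycle x y ↔ f x = f y

theorem IsCycleLabelling.apply_eq {X ι : Type*} {σ : Equiv.Perm X} {f : X → ι}
    (h : IsCycleLabelling σ f) (x : X) : f (σ x) = f x :=
  ((h _ _).1 (Equiv.Perm.sameCycle_apply_left.2 (Equiv.Perm.SameCycle.refl σ x)))

theorem isCycleLabelling_quotient {X : Type*} (σ : Equiv.Perm X) :
    IsCycleLabelling σ (Quotient.mk (Equiv.Perm.SameCycle.setoid σ)) :=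
  fun _ _ => (Quotient.eq (r := Equiv.Perm.SameCycle.setoid σ)).symm

theorem isCycleOn_univ_iff {X : Type*} (σ : Equiv.Perm X) :
    σ.IsCycleOn Set.univ ↔ ∀ x y, σ.SameCycle x y := by
  constructor
  · intro h x y
    exact h.2 (Set.mem_univ x) (Set.mem_univ y)
  · intro h
    exact ⟨Set.bijOn_univ.2 σ.bijective, fun x _ y _ => h x y⟩

theorem IsCycleLabelling.mem_support_iff {X ι : Type*} [Fintype X] [DecidableEq X] [DecidableEq ι]
    {σ : Equiv.Perm X} {f : X → ι} (h : IsCycleLabelling σ f) (x : X) :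
    x ∈ σ.support ↔ 1 < (Finset.univ.filter fun y => f y = f x).card := by
  rw [Finset.one_lt_card_iff, Equiv.Perm.mem_support]
  constructor
  · intro hx
    exact ⟨σ x, x, by simp [h.apply_eq], by simp, hx⟩
  · rintro ⟨a, b, ha, hb, hab⟩ hx
    simp only [Finset.mem_filter, Finset.mem_univ, true_and] at ha hb
    have h1 := (h x a).2 ha.symm
    have h2 := (h x b).2 hb.symm
    have hx' : Function.IsFixedPt σ x := hx
    exact hab ((h1.eq_of_left hx').symm.trans (h2.eq_of_left hx'))

theorem IsCycleLabelling.support_cycleOf {X ι : Type*} [Fintype X] [DecidableEq X] [DecidableEq ι]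
    {σ : Equiv.Perm X} {f : X → ι} (h : IsCycleLabelling σ f) {x : X} (hx : x ∈ σ.support) :
    (σ.cycleOf x).support = Finset.univ.filter fun y => f y = f x := by
  ext y
  rw [Equiv.Perm.mem_support_cycleOf_iff]
  simp [hx, h x y, eq_comm]

/-- A section `g` of `f` picks a representative of each fibre; `i ↦ σ.cycleOf (g i)` matches the
fibres with more than one element with the nontrivial cycles. -/
theorem IsCycleLabelling.cycleType_eq {X ι : Type*} [Fintype X] [DecidableEq X] [Fintype ι]
    [DecidableEq ι] {σ : Equiv.Perm X} {f : X → ι} (h : IsCycleLabelling σ f)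
    (hf : Function.Surjective f) :
    σ.cycleType = ((Finset.univ.filter fun i : ι => 1 < (Finset.univ.filter fun x => f x = i).card).val.map
      fun i => (Finset.univ.filter fun x => f x = i).card) := by
  classical
  obtain ⟨g, hg⟩ := hf.hasRightInverse
  have hsup : ∀ i, 1 < (Finset.univ.filter fun x => f x = i).card → g i ∈ σ.support := by
    intro i hi
    rw [h.mem_support_iff, hg]
    exact hi
  have hinj : Set.InjOn (fun i => σ.cycleOf (g i))
      ((Finset.univ.filter fun i : ι => 1 < (Finset.univ.filter fun x => f x = i).card) : Finset ι) := by
    intro i hi j hj hij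
    simp only [Finset.coe_filter, Finset.mem_univ, true_and, Set.mem_ofPred_eq] at hi hj
    have h1 : g i ∈ (σ.cycleOf (g i)).support := by
      rw [h.support_cycleOf (hsup i hi)]; simp
    have hij' : σ.cycleOf (g i) = σ.cycleOf (g j) := hij
    rw [hij', h.support_cycleOf (hsup j hj)] at h1
    simpa [hg i, hg j] using h1
  have himg : σ.cycleFactorsFinset =
      (Finset.univ.filter fun i : ι => 1 < (Finset.univ.filter fun x => f x = i).card).image
        (fun i => σ.cycleOf (g i)) := by
    ext c
    simp only [Finset.mem_image, Finset.mem_filter, Finset.mem_univ, true_and]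
    constructor
    · intro hc
      obtain ⟨x, hx⟩ := (Equiv.Perm.mem_cycleFactorsFinset_iff.1 hc).1.nonempty_support
      have hcx := Equiv.Perm.cycle_is_cycleOf hx hc
      have hxs : x ∈ σ.support := Equiv.Perm.mem_cycleFactorsFinset_support_le hc hx
      refine ⟨f x, (h.mem_support_iff x).1 hxs, ?_⟩
      rw [hcx]
      exact ((h _ _).2 (hg (f x))).cycleOf_eq
    · rintro ⟨i, hi, rfl⟩
      exact Equiv.Perm.cycleOf_mem_cycleFactorsFinset_iff.2 (hsup i hi)
  rw [Equiv.Perm.cycleType_def, himg, Finset.image_val_of_injOn hinj, Multiset.map_map]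
  refine Multiset.map_congr rfl fun i hi => ?_
  have hi' : 1 < (Finset.univ.filter fun x => f x = i).card := by simpa using hi
  simp only [Function.comp_apply]
  rw [h.support_cycleOf (hsup i hi'), hg]

/-- `cycleType_eq` accounts for the large fibres. The remaining ones are singletons, and their
number agrees with that of the fixed points because both sides sum to the size of `X`. -/
theorem IsCycleLabelling.parts_partition_eq {X ι : Type*} [Fintype X] [DecidableEq X] [Fintype ι]
    [DecidableEq ι] {σ : Equiv.Perm X} {f : X → ι} (h : IsCycleLabelling σ f)
    (hf : Function.Surjective f) :
    σ.partition.parts =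
      (Finset.univ : Finset ι).val.map fun i => (Finset.univ.filter fun x => f x = i).card := by
  classical
  set sz : ι → ℕ := fun i => (Finset.univ.filter fun x => f x = i).card with hsz
  have hpos : ∀ i, 0 < sz i := by
    intro i
    obtain ⟨x, hx⟩ := hf i
    exact Finset.card_pos.2 ⟨x, by simpa using hx⟩
  have hct : σ.cycleType = ((Finset.univ.filter fun i : ι => 1 < sz i).val.map sz) :=
    h.cycleType_eq hf
  have hrest : ((Finset.univ.filter fun i : ι => ¬ 1 < sz i).val.map sz) =
      Multiset.replicate (Finset.univ.filter fun i : ι => ¬ 1 < sz i).card 1 := by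
    refine Multiset.eq_replicate.2 ⟨Multiset.card_map _ _, fun b hb => ?_⟩
    obtain ⟨i, hi, rfl⟩ := Multiset.mem_map.1 hb
    have : ¬ 1 < sz i := by simpa using hi
    have := hpos i
    omega
  have hsplit : (Finset.univ : Finset ι).val.map sz = σ.cycleType +
      Multiset.replicate (Finset.univ.filter fun i : ι => ¬ 1 < sz i).card 1 := by
    rw [hct, ← hrest, ← Multiset.map_add, Finset.filter_val, Finset.filter_val,
      Multiset.filter_add_not]
  have hsum : ((Finset.univ : Finset ι).val.map sz).sum = Fintype.card X := by
    rw [← Finset.card_univ]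
    exact (Finset.card_eq_sum_card_fiberwise (f := f) (t := Finset.univ)
      (fun x _ => Finset.mem_coe.2 (Finset.mem_univ _))).symm
  rw [hsplit, Multiset.sum_add, Equiv.Perm.sum_cycleType, Multiset.sum_replicate] at hsum
  rw [hsplit, Equiv.Perm.parts_partition]
  congr 2
  simp only [smul_eq_mul, mul_one] at hsum
  omega

/-- The size of the cycle of `σ` through `a` (fixed points have cycle size `1`). -/
noncomputable def cycleSize {X : Type*} (σ : Equiv.Perm X) (a : X) : ℕ :=
  Nat.card {y // σ.SameCycle a y}

theorem IsCycleLabelling.cycleSize_eq {X ι : Type*} [Fintype X] [DecidableEq ι]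
    {σ : Equiv.Perm X} {f : X → ι} (h : IsCycleLabelling σ f) (a : X) :
    cycleSize σ a = (Finset.univ.filter fun x => f x = f a).card := by
  classical
  rw [cycleSize, Nat.card_eq_fintype_card, Fintype.card_subtype]
  congr 1
  ext y
  simp [h a y, eq_comm]

/-- A cycle of length `k` has `k` points, each contributing `G k`. -/
theorem sum_cycleSize {X : Type*} [Fintype X] [DecidableEq X] (σ : Equiv.Perm X) (G : ℕ → ℕ) :
    ∑ a, G (cycleSize σ a) = (σ.partition.parts.map fun k => k * G k).sum := by
  classical
  have : Fintype (Quotient (Equiv.Perm.SameCycle.setoid σ)) := Fintype.ofFinite _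
  have h := isCycleLabelling_quotient σ
  rw [h.parts_partition_eq Quotient.mk_surjective, Multiset.map_map,
    ← Finset.sum_fiberwise_of_maps_to (g := Quotient.mk (Equiv.Perm.SameCycle.setoid σ))
      (t := Finset.univ) (fun _ _ => Finset.mem_univ _)]
  refine Finset.sum_congr rfl fun i _ => ?_
  rw [Finset.sum_congr rfl (g := fun _ => G (Finset.univ.filter fun x =>
    Quotient.mk (Equiv.Perm.SameCycle.setoid σ) x = i).card)]
  · simp
  · intro x hx
    rw [h.cycleSize_eq, (Finset.mem_filter.1 hx).2]

theorem parts_partition_conj {X : Type*} [Fintype X] [DecidableEq X] (σ τ : Equiv.Perm X) :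
    (τ * σ * τ⁻¹).partition.parts = σ.partition.parts := by
  rw [← Equiv.Perm.partition_eq_of_isConj.1 (isConj_iff.2 ⟨τ, rfl⟩)]

theorem isCycleOn_univ_conj {X : Type*} (σ τ : Equiv.Perm X) :
    (τ * σ * τ⁻¹).IsCycleOn Set.univ ↔ σ.IsCycleOn Set.univ := by
  simp only [isCycleOn_univ_iff, Equiv.Perm.sameCycle_conj]
  exact ⟨fun h x y => by simpa using h (τ x) (τ y), fun h x y => h _ _⟩

theorem count_one_parts_partition {X : Type*} [Fintype X] [DecidableEq X] (σ : Equiv.Perm X) :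
    σ.partition.parts.count 1 = (Finset.univ.filter fun x => σ x = x).card := by
  classical
  rw [Equiv.Perm.parts_partition, Multiset.count_add, Multiset.count_replicate_self,
    Multiset.count_eq_zero_of_notMem, zero_add]
  · rw [← Finset.card_compl]
    congr 1
    ext x
    simp
  · intro h
    exact absurd (Equiv.Perm.one_lt_of_mem_cycleType h) (lt_irrefl _)

/-! ### Inserting a new point into a permutation -/

/-- `decomposeFin.symm (a.succ, σ)` is `σ` on successors with `0` spliced in just before `a`: it
sends `0` to `a.succ`, and whatever went to `a` now goes to `0`. So `0` inherits the label of `a`,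
and no other cycle changes. -/
theorem IsCycleLabelling.insert {n : ℕ} {ι : Type*} {σ : Equiv.Perm (Fin n)} {f : Fin n → ι}
    (h : IsCycleLabelling σ f) (a : Fin n) :
    IsCycleLabelling (decomposeFin.symm (a.succ, σ)) (Fin.cons (f a) f : Fin (n + 1) → ι) := by
  set τ := decomposeFin.symm (a.succ, σ) with hτ
  have hzero : τ 0 = a.succ := by simp [hτ]
  have hstep : ∀ x, τ.SameCycle x.succ (σ x).succ := by
    intro x
    by_cases hx : σ x = a
    · have h1 : τ x.succ = 0 := by simp [hτ, hx]
      rw [hx, ← hzero, Equiv.Perm.sameCycle_apply_right, ← h1, Equiv.Perm.sameCycle_apply_right]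
    · have h1 : τ x.succ = (σ x).succ := by
        rw [hτ, Equiv.Perm.decomposeFin_symm_apply_succ, Equiv.swap_apply_of_ne_of_ne]
        · exact Fin.succ_ne_zero _
        · simpa using hx
      rw [← h1, Equiv.Perm.sameCycle_apply_right]
  have hsucc : ∀ x y, σ.SameCycle x y → τ.SameCycle x.succ y.succ := by
    intro x y hxy
    obtain ⟨i, -, rfl⟩ := hxy.exists_pow_eq'
    clear hxy
    induction i with
    | zero => exact Equiv.Perm.SameCycle.refl _ _
    | succ i ih =>
      rw [pow_succ', Equiv.Perm.mul_apply]
      exact ih.trans (hstep _)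
  have h0 : τ.SameCycle 0 a.succ := by
    rw [← hzero, Equiv.Perm.sameCycle_apply_right]
  have hinv : ∀ x : Fin (n + 1), (Fin.cons (f a) f : Fin (n + 1) → ι) (τ x) =
      (Fin.cons (f a) f : Fin (n + 1) → ι) x := by
    intro x
    refine Fin.cases ?_ (fun x => ?_) x
    · simp [hzero]
    · by_cases hx : σ x = a
      · have h1 : τ x.succ = 0 := by simp [hτ, hx]
        rw [h1, Fin.cons_zero, Fin.cons_succ, ← hx, h.apply_eq]
      · have h1 : τ x.succ = (σ x).succ := by
          rw [hτ, Equiv.Perm.decomposeFin_symm_apply_succ, Equiv.swap_apply_of_ne_of_ne]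
          · exact Fin.succ_ne_zero _
          · simpa using hx
        rw [h1, Fin.cons_succ, Fin.cons_succ, h.apply_eq]
  intro x y
  constructor
  · intro hxy
    obtain ⟨i, -, rfl⟩ := hxy.exists_pow_eq'
    clear hxy
    induction i with
    | zero => simp
    | succ i ih => rw [pow_succ', Equiv.Perm.mul_apply, hinv, ih]
  · refine Fin.cases ?_ (fun x => ?_) x <;> refine Fin.cases ?_ (fun y => ?_) y
    · exact fun _ => Equiv.Perm.SameCycle.refl _ _
    · intro hy
      exact h0.trans (hsucc _ _ ((h _ _).2 (by simpa using hy)))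
    · intro hy
      exact (h0.trans (hsucc _ _ ((h _ _).2 (by simpa using hy.symm)))).symm
    · intro hy
      exact hsucc _ _ ((h _ _).2 (by simpa using hy))

theorem parts_partition_insert {n : ℕ} (σ : Equiv.Perm (Fin n)) (a : Fin n) :
    (decomposeFin.symm (a.succ, σ)).partition.parts =
      (cycleSize σ a + 1) ::ₘ σ.partition.parts.erase (cycleSize σ a) := by
  classical
  have : Fintype (Quotient (Equiv.Perm.SameCycle.setoid σ)) := Fintype.ofFinite _
  have h := isCycleLabelling_quotient σ
  set f := Quotient.mk (Equiv.Perm.SameCycle.setoid σ) with hf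
  have hs : Function.Surjective f := Quotient.mk_surjective
  have hs' : Function.Surjective (Fin.cons (f a) f : Fin (n + 1) → _) := by
    intro i
    obtain ⟨x, hx⟩ := hs i
    exact ⟨x.succ, by simpa using hx⟩
  rw [(h.insert a).parts_partition_eq hs', h.parts_partition_eq hs, h.cycleSize_eq,
    ← Multiset.map_erase_of_mem (fun i => (Finset.univ.filter fun x => f x = i).card) _
      (Finset.mem_univ (f a) : f a ∈ Finset.univ.val)]
  nth_rw 1 [← Multiset.cons_erase (Finset.mem_univ (f a) : f a ∈ Finset.univ.val)]
  rw [Multiset.map_cons]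
  have hcard : ∀ i, (Finset.univ.filter fun x : Fin (n + 1) =>
      (Fin.cons (f a) f : Fin (n + 1) → _) x = i).card =
      (if f a = i then 1 else 0) + (Finset.univ.filter fun x => f x = i).card := by
    intro i
    rw [Fin.card_filter_univ_succ]
    simp only [Fin.cons_zero]
    split_ifs <;> simp [add_comm]
  congr 1
  · rw [hcard]
    simp [add_comm]
  · refine Multiset.map_congr rfl fun i hi => ?_
    have : i ≠ f a := by
      rintro rfl
      exact (Finset.univ : Finset (Quotient (Equiv.Perm.SameCycle.setoid σ))).nodup.notMem_erase hi
    rw [hcard, if_neg (Ne.symm this), zero_add]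

theorem IsCycleLabelling.insert_fixed {n : ℕ} {ι : Type*} {σ : Equiv.Perm (Fin n)} {f : Fin n → ι}
    (h : IsCycleLabelling σ f) :
    IsCycleLabelling (decomposeFin.symm (0, σ))
      (Fin.cons none (fun x => some (f x)) : Fin (n + 1) → Option ι) := by
  set τ := decomposeFin.symm (0, σ) with hτ
  have hfix : Function.IsFixedPt τ 0 := by simp [hτ, Function.IsFixedPt]
  have hpow : ∀ (i : ℕ) (x : Fin n), (τ ^ i) x.succ = ((σ ^ i) x).succ := by
    intro i x
    induction i with
    | zero => simp
    | succ i ih => rw [pow_succ', Equiv.Perm.mul_apply, ih, pow_succ', Equiv.Perm.mul_apply]; simp [hτ]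
  have hne : ∀ y : Fin n, ¬ τ.SameCycle 0 y.succ := fun y hy =>
    Fin.succ_ne_zero y (hy.eq_of_left hfix).symm
  intro x y
  refine Fin.cases ?_ (fun x => ?_) x <;> refine Fin.cases ?_ (fun y => ?_) y
  · exact ⟨fun _ => rfl, fun _ => Equiv.Perm.SameCycle.refl _ _⟩
  · simpa using hne y
  · simpa [Equiv.Perm.sameCycle_comm] using hne x
  · rw [Fin.cons_succ, Fin.cons_succ, Option.some_inj, ← h x y]
    constructor
    · intro hxy
      obtain ⟨i, -, hi⟩ := Equiv.Perm.SameCycle.exists_pow_eq' hxy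
      have hi' := (hpow i x).symm.trans hi
      exact ⟨i, by rw [zpow_natCast]; exact Fin.succ_injective _ hi'⟩
    · intro hxy
      obtain ⟨i, -, rfl⟩ := Equiv.Perm.SameCycle.exists_pow_eq' hxy
      exact ⟨i, by rw [zpow_natCast, hpow]⟩

theorem parts_partition_decomposeFin_zero {n : ℕ} (σ : Equiv.Perm (Fin n)) :
    (decomposeFin.symm (0, σ)).partition.parts = 1 ::ₘ σ.partition.parts := by
  classical
  have : Fintype (Quotient (Equiv.Perm.SameCycle.setoid σ)) := Fintype.ofFinite _
  have h := isCycleLabelling_quotient σ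
  set f := Quotient.mk (Equiv.Perm.SameCycle.setoid σ) with hf
  have hs : Function.Surjective f := Quotient.mk_surjective
  have hs' : Function.Surjective
      (Fin.cons none (fun x => some (f x)) : Fin (n + 1) → Option _) := by
    rintro (_ | i)
    · exact ⟨0, rfl⟩
    · obtain ⟨x, hx⟩ := hs i
      exact ⟨x.succ, by simpa using hx⟩
  have hu : (Finset.univ : Finset (Option (Quotient (Equiv.Perm.SameCycle.setoid σ)))).val =
      none ::ₘ Finset.univ.val.map some := rfl
  rw [h.insert_fixed.parts_partition_eq hs', h.parts_partition_eq hs, hu, Multiset.map_cons,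
    Multiset.map_map]
  congr 1
  · rw [Fin.card_filter_univ_succ]
    simp
  · refine Multiset.map_congr rfl fun i _ => ?_
    rw [Function.comp_apply, Fin.card_filter_univ_succ]
    simp

theorem isCycleOn_univ_insert {n : ℕ} (σ : Equiv.Perm (Fin n)) (a : Fin n) :
    (decomposeFin.symm (a.succ, σ)).IsCycleOn Set.univ ↔ σ.IsCycleOn Set.univ := by
  rw [isCycleOn_univ_iff, isCycleOn_univ_iff]
  constructor
  · intro h x y
    have h1 := ((isCycleLabelling_quotient σ).insert a _ _).1 (h x.succ y.succ)
    simp only [Fin.cons_succ] at h1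
    exact (isCycleLabelling_quotient σ _ _).2 h1
  · intro h x y
    have hl : IsCycleLabelling σ (fun _ => ()) := fun x y => by simp [h x y]
    rw [hl.insert a x y]

/-- When the second factor fixes `0`, deleting `0` is compatible with the product. This is what
reduces a factorization of an (n+1)-cycle to one of an n-cycle. -/
theorem decomposeFin_symm_mul {n : ℕ} (p : Fin (n + 1)) (σ τ : Equiv.Perm (Fin n)) :
    decomposeFin.symm (p, σ) * decomposeFin.symm (0, τ) = decomposeFin.symm (p, σ * τ) := by
  ext x
  refine Fin.cases ?_ (fun x => ?_) x <;> simp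

theorem not_isCycleOn_univ_decomposeFin_zero {n : ℕ} (hn : 0 < n) (σ : Equiv.Perm (Fin n)) :
    ¬ (decomposeFin.symm (0, σ)).IsCycleOn Set.univ := by
  rw [isCycleOn_univ_iff]
  intro h
  have h1 := (h 0 (Fin.succ ⟨0, hn⟩)).eq_of_left
    (by simp [Function.IsFixedPt])
  exact (Fin.succ_ne_zero _) h1.symm

/-! ### Minimal factorizations of long cycles -/

/-- The product of the factorials of the multiplicities of a multiset. -/
def countFactorial (A : Multiset ℕ) : ℕ := ∏ i ∈ A.toFinset, (A.count i)!

theorem countFactorial_eq_prod {A : Multiset ℕ} {s : Finset ℕ} (h : A.toFinset ⊆ s) :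
    countFactorial A = ∏ i ∈ s, (A.count i)! := by
  refine Finset.prod_subset h fun i _ hi => ?_
  rw [Multiset.count_eq_zero_of_notMem (by simpa using hi), Nat.factorial_zero]

theorem countFactorial_cons (a : ℕ) (A : Multiset ℕ) :
    countFactorial (a ::ₘ A) = (A.count a + 1) * countFactorial A := by
  have h1 : A.toFinset ⊆ (a ::ₘ A).toFinset := by
    intro i hi
    simp only [Multiset.mem_toFinset, Multiset.mem_cons] at hi ⊢
    exact Or.inr hi
  have ha : a ∈ (a ::ₘ A).toFinset := by simp
  rw [countFactorial_eq_prod h1, countFactorial, ← Finset.mul_prod_erase _ _ ha,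
    ← Finset.mul_prod_erase _ (fun i => (A.count i)!) ha, Multiset.count_cons_self,
    Nat.factorial_succ, mul_assoc]
  congr 2
  refine Finset.prod_congr rfl fun i hi => ?_
  rw [Multiset.count_cons_of_ne (Finset.ne_of_mem_erase hi)]

theorem countFactorial_pos (A : Multiset ℕ) : 0 < countFactorial A :=
  Finset.prod_pos fun _ _ => Nat.factorial_pos _

theorem countFactorial_eq_mul_erase {a : ℕ} {A : Multiset ℕ} (ha : a ∈ A) :
    countFactorial A = A.count a * countFactorial (A.erase a) := by
  conv_lhs => rw [← Multiset.cons_erase ha, countFactorial_cons]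
  rw [Multiset.count_erase_self, Nat.sub_add_cancel (Multiset.count_pos.2 ha)]

open Classical in
/-- The pairs `(α, β)` of permutations of `[n]` of cycle types `A` and `B` whose product
is an `n`-cycle. -/
noncomputable def cycleFactorizations (n : ℕ) (A B : Multiset ℕ) :
    Finset (Equiv.Perm (Fin n) × Equiv.Perm (Fin n)) :=
  Finset.univ.filter fun p => (p.1 * p.2).IsCycleOn Set.univ ∧
    p.1.partition.parts = A ∧ p.2.partition.parts = B

theorem mem_cycleFactorizations {n : ℕ} {A B : Multiset ℕ}
    {p : Equiv.Perm (Fin n) × Equiv.Perm (Fin n)} :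
    p ∈ cycleFactorizations n A B ↔ (p.1 * p.2).IsCycleOn Set.univ ∧
    p.1.partition.parts = A ∧ p.2.partition.parts = B := by
  simp [cycleFactorizations]

theorem card_cycleFactorizations_comm (n : ℕ) (A B : Multiset ℕ) :
    (cycleFactorizations n A B).card = (cycleFactorizations n B A).card := by
  refine Finset.card_bij' (fun p _ => (p.2, p.1)) (fun p _ => (p.2, p.1)) ?_ ?_ ?_ ?_
  · rintro ⟨α, β⟩ h
    rw [mem_cycleFactorizations] at h ⊢
    refine ⟨?_, h.2.2, h.2.1⟩
    rw [← isCycleOn_univ_conj _ α]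
    simpa [mul_assoc] using h.1
  · rintro ⟨α, β⟩ h
    rw [mem_cycleFactorizations] at h ⊢
    refine ⟨?_, h.2.2, h.2.1⟩
    rw [← isCycleOn_univ_conj _ α]
    simpa [mul_assoc] using h.1
  · intros; rfl
  · intros; rfl

/-- The number of cycle factorizations satisfying a condition on `(β, x)` is invariant under
simultaneous conjugation. -/
theorem card_filter_cycleFactorizations_conj {n : ℕ} (A B : Multiset ℕ)
    (P Q : Equiv.Perm (Fin n) → Prop) [DecidablePred P] [DecidablePred Q]
    (τ : Equiv.Perm (Fin n)) (hPQ : ∀ β, P β ↔ Q (τ * β * τ⁻¹)) :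
    ((cycleFactorizations n A B).filter fun p => P p.2).card =
      ((cycleFactorizations n A B).filter fun p => Q p.2).card := by
  refine Finset.card_bij' (fun p _ => (τ * p.1 * τ⁻¹, τ * p.2 * τ⁻¹))
    (fun p _ => (τ⁻¹ * p.1 * τ, τ⁻¹ * p.2 * τ)) ?_ ?_ ?_ ?_
  · rintro ⟨α, β⟩ h
    rw [Finset.mem_filter, mem_cycleFactorizations] at h ⊢
    refine ⟨⟨?_, ?_, ?_⟩, (hPQ _).1 h.2⟩
    · have := (isCycleOn_univ_conj _ τ).2 h.1.1
      simpa [mul_assoc] using this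
    · simpa only [parts_partition_conj] using h.1.2.1
    · simpa only [parts_partition_conj] using h.1.2.2
  · rintro ⟨α, β⟩ h
    rw [Finset.mem_filter, mem_cycleFactorizations] at h ⊢
    have hc : ∀ γ : Equiv.Perm (Fin n), τ⁻¹ * γ * τ = τ⁻¹ * γ * τ⁻¹⁻¹ := fun γ => by rw [inv_inv]
    refine ⟨⟨?_, ?_, ?_⟩, (hPQ _).2 ?_⟩
    · have := (isCycleOn_univ_conj _ τ⁻¹).2 h.1.1
      simpa [mul_assoc] using this
    · simpa only [hc, parts_partition_conj] using h.1.2.1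
    · simpa only [hc, parts_partition_conj] using h.1.2.2
    · simpa [mul_assoc] using h.2
  · intros; simp [mul_assoc]
  · intros; simp [mul_assoc]

open Classical in
/-- The factorizations of an `(n+1)`-cycle whose second factor fixes `0` arise by insertion. -/
theorem card_filter_fix_zero {n : ℕ} (hn : 0 < n) (A B : Multiset ℕ) :
    ((cycleFactorizations (n + 1) A (1 ::ₘ B)).filter fun p => p.2 0 = 0).card =
      ∑ p : Equiv.Perm (Fin n) × Equiv.Perm (Fin n),
        if (p.1 * p.2).IsCycleOn Set.univ ∧ p.2.partition.parts = B then
          (Finset.univ.filter fun a => (cycleSize p.1 a + 1) ::ₘ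
            p.1.partition.parts.erase (cycleSize p.1 a) = A).card else 0 := by
  classical
  have h1 : ∀ p : Equiv.Perm (Fin n) × Equiv.Perm (Fin n),
      (if (p.1 * p.2).IsCycleOn Set.univ ∧ p.2.partition.parts = B then
          (Finset.univ.filter fun a => (cycleSize p.1 a + 1) ::ₘ
            p.1.partition.parts.erase (cycleSize p.1 a) = A).card else 0) =
      (Finset.univ.filter fun a => ((p.1 * p.2).IsCycleOn Set.univ ∧ p.2.partition.parts = B) ∧
        (cycleSize p.1 a + 1) ::ₘ p.1.partition.parts.erase (cycleSize p.1 a) = A).card := by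
    intro p
    split_ifs with h <;> simp [h]
  rw [Finset.sum_congr rfl fun p _ => h1 p, ← Finset.card_sigma]
  symm
  refine Finset.card_bij
    (fun x _ => (decomposeFin.symm (x.2.succ, x.1.1), decomposeFin.symm (0, x.1.2))) ?_ ?_ ?_
  · rintro ⟨⟨α, β⟩, a⟩ h
    simp only [Finset.mem_sigma, Finset.mem_univ, Finset.mem_filter, true_and] at h
    simp only [Finset.mem_filter, mem_cycleFactorizations, decomposeFin_symm_mul,
      isCycleOn_univ_insert, parts_partition_insert, parts_partition_decomposeFin_zero]
    exact ⟨⟨h.1.1, h.2, by rw [h.1.2]⟩, by simp⟩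
  · rintro ⟨⟨α, β⟩, a⟩ _ ⟨⟨α', β'⟩, a'⟩ _ h
    simp only [Prod.mk.injEq, EmbeddingLike.apply_eq_iff_eq, Fin.succ_inj, true_and] at h
    obtain ⟨⟨rfl, rfl⟩, rfl⟩ := h
    rfl
  · rintro ⟨α, β⟩ h
    rw [Finset.mem_filter, mem_cycleFactorizations] at h
    obtain ⟨⟨hc, hA, hB⟩, h0⟩ := h
    obtain ⟨⟨p, α⟩, rfl⟩ := decomposeFin.symm.surjective α
    obtain ⟨⟨q, β⟩, rfl⟩ := decomposeFin.symm.surjective β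
    simp only [Equiv.Perm.decomposeFin_symm_apply_zero] at h0
    subst h0
    simp only [decomposeFin_symm_mul] at hc
    -- If the first factor fixed `0` too, so would the product, which is a cycle on more than one
    -- point.
    rcases Fin.eq_zero_or_eq_succ p with rfl | ⟨a, rfl⟩
    · exact absurd hc (not_isCycleOn_univ_decomposeFin_zero hn _)
    · simp only [parts_partition_insert, parts_partition_decomposeFin_zero] at hA hB
      rw [isCycleOn_univ_insert] at hc
      refine ⟨⟨(α, β), a⟩, ?_, rfl⟩
      simp only [Finset.mem_sigma, Finset.mem_univ, Finset.mem_filter, true_and]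
      exact ⟨⟨hc, (Multiset.cons_inj_right _).1 hB⟩, hA⟩

/-- Double count pairs (factorization, fixed point of the second factor); conjugating by `swap 0 x`
shows that every point `x` is fixed equally often. -/
theorem count_one_mul_card_cycleFactorizations {n : ℕ} (A B : Multiset ℕ) :
    B.count 1 * (cycleFactorizations (n + 1) A B).card =
      (n + 1) * ((cycleFactorizations (n + 1) A B).filter fun p => p.2 0 = 0).card := by
  classical
  have h1 : B.count 1 * (cycleFactorizations (n + 1) A B).card =
      ∑ p ∈ cycleFactorizations (n + 1) A B, (Finset.univ.filter fun x => p.2 x = x).card := by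
    rw [Finset.sum_congr rfl fun p hp => by
      rw [← count_one_parts_partition, (mem_cycleFactorizations.1 hp).2.2]]
    simp [mul_comm]
  have h2 : ∀ x : Fin (n + 1), ((cycleFactorizations (n + 1) A B).filter fun p => p.2 x = x).card =
      ((cycleFactorizations (n + 1) A B).filter fun p => p.2 0 = 0).card := by
    intro x
    refine card_filter_cycleFactorizations_conj A B (fun β => β x = x) (fun β => β 0 = 0)
      (Equiv.swap 0 x) fun β => ?_
    simp only [Equiv.Perm.mul_apply, Equiv.swap_inv, Equiv.swap_apply_left]
    rw [← Equiv.apply_eq_iff_eq (Equiv.swap 0 x) (x := β x), Equiv.swap_apply_right]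
  rw [h1]
  simp only [Finset.card_filter _ Finset.univ]
  rw [Finset.sum_comm]
  simp only [← Finset.card_filter]
  rw [Finset.sum_congr rfl fun x _ => h2 x]
  simp

theorem sum_map_eq_sum_range (T : Multiset ℕ) (g : ℕ → ℕ) {N : ℕ} (hN : ∀ k ∈ T, k < N) :
    (T.map g).sum = ∑ k ∈ Finset.range N, T.count k * g k := by
  rw [Finset.sum_multiset_map_count]
  simp only [smul_eq_mul]
  refine Finset.sum_subset (fun k hk => ?_) fun k _ hk => ?_
  · exact Finset.mem_range.2 (hN k (by simpa using hk))
  · rw [Multiset.count_eq_zero_of_notMem (by simpa using hk), zero_mul]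

theorem cons_succ_erase_eq_iff {A T : Multiset ℕ} {k : ℕ} (hk : k ∈ T) :
    (k + 1) ::ₘ T.erase k = A ↔ k + 1 ∈ A ∧ T = k ::ₘ A.erase (k + 1) := by
  constructor
  · rintro rfl
    exact ⟨Multiset.mem_cons_self _ _, by rw [Multiset.erase_cons_head, Multiset.cons_erase hk]⟩
  · rintro ⟨h1, rfl⟩
    rw [Multiset.erase_cons_head, Multiset.cons_erase h1]

theorem lt_of_mem_parts_partition {n : ℕ} (σ : Equiv.Perm (Fin n)) {k : ℕ}
    (hk : k ∈ σ.partition.parts) : k < n + 1 := by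
  have := Multiset.le_sum_of_mem hk
  rw [σ.partition.parts_sum, Fintype.card_fin] at this
  omega

/-- Insertions are sorted by the length `k` of the cycle that receives `0`. The type before
insertion is then determined, and a permutation of that type has `k` times the multiplicity of `k`
admissible points. -/
theorem card_filter_fix_zero_eq_sum {n : ℕ} (hn : 0 < n) (A B : Multiset ℕ) :
    ((cycleFactorizations (n + 1) A (1 ::ₘ B)).filter fun p => p.2 0 = 0).card =
      ∑ k ∈ Finset.range (n + 1), if k + 1 ∈ A then
        k * (k ::ₘ A.erase (k + 1)).count k *
          (cycleFactorizations n (k ::ₘ A.erase (k + 1)) B).card else 0 := by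
  classical
  rw [card_filter_fix_zero hn]
  have h1 : ∀ σ : Equiv.Perm (Fin n), (Finset.univ.filter fun a => (cycleSize σ a + 1) ::ₘ
            σ.partition.parts.erase (cycleSize σ a) = A).card =
      ∑ k ∈ Finset.range (n + 1), if k + 1 ∈ A ∧ σ.partition.parts = k ::ₘ A.erase (k + 1)
        then k * (k ::ₘ A.erase (k + 1)).count k else 0 := by
    intro σ
    rw [Finset.card_filter, sum_cycleSize σ fun k => if (k + 1) ::ₘ
            σ.partition.parts.erase k = A then 1 else 0,
      sum_map_eq_sum_range _ _ fun k hk => lt_of_mem_parts_partition σ hk]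
    refine Finset.sum_congr rfl fun k _ => ?_
    by_cases hk : k ∈ σ.partition.parts
    · simp only [cons_succ_erase_eq_iff hk]
      split_ifs with h
      · rw [← h.2]; ring
      · simp
    · rw [Multiset.count_eq_zero_of_notMem hk, zero_mul, if_neg]
      rintro ⟨-, h⟩
      exact hk (h ▸ Multiset.mem_cons_self _ _)
  simp only [h1]
  rw [Finset.sum_congr rfl (g := fun p : Equiv.Perm (Fin n) × Equiv.Perm (Fin n) =>
    ∑ k ∈ Finset.range (n + 1), if k + 1 ∈ A ∧
      p ∈ cycleFactorizations n (k ::ₘ A.erase (k + 1)) B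
        then k * (k ::ₘ A.erase (k + 1)).count k else 0), Finset.sum_comm]
  · refine Finset.sum_congr rfl fun k _ => ?_
    split_ifs with h
    · simp [h, mul_comm]
    · simp [h]
  · intro p _
    simp only [mem_cycleFactorizations]
    split_ifs with h
    · refine Finset.sum_congr rfl fun k _ => if_congr ?_ rfl rfl
      tauto
    · refine (Finset.sum_eq_zero fun k _ => if_neg ?_).symm
      tauto

theorem sum_mul_count_succ {A : Multiset ℕ} (hA : ∀ k ∈ A, 0 < k) {N : ℕ}
    (hN : ∀ k ∈ A, k ≤ N) :
    ∑ k ∈ Finset.range N, k * A.count (k + 1) + A.card = A.sum := by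
  have h1 := sum_map_eq_sum_range A id (N := N + 1) fun k hk => Nat.lt_succ_of_le (hN k hk)
  have h2 := sum_map_eq_sum_range A (fun _ => 1) (N := N + 1) fun k hk => Nat.lt_succ_of_le (hN k hk)
  have h0 : A.count 0 = 0 := Multiset.count_eq_zero_of_notMem fun h => lt_irrefl _ (hA 0 h)
  rw [Finset.sum_range_succ', h0] at h1 h2
  simp only [id_eq, mul_zero, add_zero, Multiset.map_const',
    Multiset.sum_replicate, smul_eq_mul, mul_one] at h1 h2
  rw [Multiset.map_id'] at h1
  rw [h1, h2, ← Finset.sum_add_distrib]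
  exact Finset.sum_congr rfl fun k _ => by ring

/-- After multiplication by the multiplicity factorials, the term of index `k` is `k * A.count (k +
1)` times a constant. Summing "part minus one" over `A` gives `A.sum - A.card = B.card`, the factor
that turns `(B.card - 1)!` into `B.card !`. -/
theorem cycleFactorizations_succ_step {n : ℕ} (hn : 0 < n)
    (ih : ∀ A B : Multiset ℕ, (∀ k ∈ A, 0 < k) → (∀ k ∈ B, 0 < k) → A.sum = n → B.sum = n →
      A.card + B.card = n + 1 →
      (cycleFactorizations n A B).card * (countFactorial A * countFactorial B) =
        n ! * ((A.card - 1)! * (B.card - 1)!))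
    (A B : Multiset ℕ) (hA : ∀ k ∈ A, 0 < k) (hB : ∀ k ∈ B, 0 < k)
    (hsA : A.sum = n + 1) (hsB : B.sum = n) (hc : A.card + B.card = n + 1) :
    (cycleFactorizations (n + 1) A (1 ::ₘ B)).card *
        (countFactorial A * countFactorial (1 ::ₘ B)) =
        (n + 1)! * ((A.card - 1)! * B.card !) := by
  have h1 := count_one_mul_card_cycleFactorizations (n := n) A (1 ::ₘ B)
  rw [card_filter_fix_zero_eq_sum hn, Multiset.count_cons_self] at h1
  have hBpos : 0 < B.card := by
    rw [Multiset.card_pos]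
    rintro rfl
    simp at hsB
    omega
  have hterm : ∀ k, (if k + 1 ∈ A then k * (k ::ₘ A.erase (k + 1)).count k *
          (cycleFactorizations n (k ::ₘ A.erase (k + 1)) B).card else 0) *
        (countFactorial A * countFactorial B) =
      k * A.count (k + 1) * (n ! * ((A.card - 1)! * (B.card - 1)!)) := by
    intro k
    split_ifs with hk
    -- For `k = 0` the induction hypothesis does not apply, as `0` would be a part; both sides
    -- vanish through the factor `k`.
    · rcases Nat.eq_zero_or_pos k with rfl | hk0
      · simp
      have hcard : (k ::ₘ A.erase (k + 1)).card = A.card := by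
        rw [Multiset.card_cons, Multiset.card_erase_add_one hk]
      have hsum : (k ::ₘ A.erase (k + 1)).sum = n := by
        have := Multiset.cons_erase hk
        have h2 := congrArg Multiset.sum this
        rw [Multiset.sum_cons, hsA] at h2
        rw [Multiset.sum_cons]
        omega
      have := ih (k ::ₘ A.erase (k + 1)) B (by
        intro j hj
        rcases Multiset.mem_cons.1 hj with rfl | hj
        · exact hk0
        · exact hA _ (Multiset.mem_of_mem_erase hj)) hB hsum hsB (by rw [hcard, hc])
      rw [hcard] at this
      rw [← this, countFactorial_eq_mul_erase hk, countFactorial_cons, Multiset.count_cons_self]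
      ring
    · rw [Multiset.count_eq_zero_of_notMem hk]
      simp
  have hsum : ∑ k ∈ Finset.range (n + 1), k * A.count (k + 1) = B.card := by
    have := sum_mul_count_succ hA (N := n + 1) fun k hk => hsA ▸ Multiset.le_sum_of_mem hk
    omega
  have hfac : B.card ! = B.card * (B.card - 1)! := (Nat.mul_factorial_pred hBpos.ne').symm
  calc _ = ((B.count 1 + 1) * (cycleFactorizations (n + 1) A (1 ::ₘ B)).card) *
        (countFactorial A * countFactorial B) := by rw [countFactorial_cons]; ring
    _ = (n + 1) * ∑ k ∈ Finset.range (n + 1), k * A.count (k + 1) *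
        (n ! * ((A.card - 1)! * (B.card - 1)!)) := by
      rw [h1, mul_assoc, Finset.sum_mul, Finset.sum_congr rfl fun k _ => hterm k]
    _ = _ := by
      rw [← Finset.sum_mul, hsum, hfac, Nat.factorial_succ]
      ring

theorem one_mem_of_card {A : Multiset ℕ} (hA : ∀ k ∈ A, 0 < k) (h : A.sum < 2 * A.card) :
    1 ∈ A := by
  by_contra h1
  have : A.card • 2 ≤ A.sum := Multiset.card_nsmul_le_sum fun k hk => by
    have := hA k hk
    have : k ≠ 1 := by
      rintro rfl
      exact h1 hk
    omega
  simp only [smul_eq_mul] at this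
  omega

/-- **Goulden–Jackson formula** for two factors: the number of minimal factorizations of `n`-cycles
with prescribed cycle types. -/
theorem card_cycleFactorizations {n : ℕ} (hn : 0 < n) :
    ∀ A B : Multiset ℕ, (∀ k ∈ A, 0 < k) → (∀ k ∈ B, 0 < k) → A.sum = n → B.sum = n →
      A.card + B.card = n + 1 →
      (cycleFactorizations n A B).card * (countFactorial A * countFactorial B) =
        n ! * ((A.card - 1)! * (B.card - 1)!) := by
  induction n, hn using Nat.le_induction with
  | base =>
    intro A B hA hB hsA hsB hc
    have key : ∀ A : Multiset ℕ, (∀ k ∈ A, 0 < k) → A.sum = 1 → A = {1} := by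
      intro A hA hs
      have hle : A.card • 1 ≤ A.sum := Multiset.card_nsmul_le_sum fun k hk => hA k hk
      have h1 : A.card = 1 := by
        have : A.card ≠ 0 := by
          intro h0
          rw [Multiset.card_eq_zero.1 h0] at hs
          simp at hs
        simp only [smul_eq_mul] at hle
        omega
      obtain ⟨a, rfl⟩ := Multiset.card_eq_one.1 h1
      simpa using hs
    rw [key A hA hsA, key B hB hsB]
    have hp : ∀ σ : Equiv.Perm (Fin 1), σ.partition.parts = {1} := fun σ =>
      key _ (fun k hk => σ.partition.parts_pos hk) (by rw [σ.partition.parts_sum]; simp)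
    have : cycleFactorizations 1 {1} {1} = Finset.univ := by
      ext p
      simp only [mem_cycleFactorizations, hp, isCycleOn_univ_iff, and_true, Finset.mem_univ,
        iff_true]
      intro x y
      rw [Subsingleton.elim x y]
    rw [this]
    simp [countFactorial]
  | succ n hn ih =>
    have main : ∀ A B : Multiset ℕ, (∀ k ∈ A, 0 < k) → (∀ k ∈ B, 0 < k) → A.sum = n + 1 →
        B.sum = n + 1 → A.card + B.card = n + 2 → 1 ∈ B →
        (cycleFactorizations (n + 1) A B).card * (countFactorial A * countFactorial B) =
          (n + 1)! * ((A.card - 1)! * (B.card - 1)!) := by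
      intro A B hA hB hsA hsB hc h1
      obtain ⟨B, rfl⟩ := Multiset.exists_cons_of_mem h1
      rw [Multiset.card_cons] at hc ⊢
      rw [Multiset.sum_cons] at hsB
      exact cycleFactorizations_succ_step hn ih A B hA
        (fun k hk => hB k (Multiset.mem_cons_of_mem hk)) hsA (by omega) (by omega)
    intro A B hA hB hsA hsB hc
    -- The lengths add up to `n + 2`, so one of the two types has average part below 2 and hence
    -- contains a 1.
    rcases Nat.lt_or_ge (n + 1) (2 * B.card) with h | h
    · exact main A B hA hB hsA hsB hc (one_mem_of_card hB (by omega))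
    · have := main B A hB hA hsB hsA (by omega) (one_mem_of_card hA (by omega))
      rw [card_cycleFactorizations_comm, mul_comm (countFactorial A), this, mul_comm (B.card - 1)!]

/-! ### Sequences of points in distinct cycles -/

/-- The sum, over the sequences of `m` distinct positions in `A`, of the products of the entries
at these positions. -/
def injectiveWeight : ℕ → Multiset ℕ → ℕ
  | 0, _ => 1
  | m + 1, A => (A.map fun r => r * injectiveWeight m (A.erase r)).sum

/-- Choose the first point, whose label lies in `s`; the later points must avoid that label. This is
the recursion of `injectiveWeight`, with the fibre sizes as entries. -/
theorem card_filter_injective_comp {X ι : Type*} [Fintype X] [DecidableEq ι] (f : X → ι) (m : ℕ)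
    (s : Finset ι) [DecidablePred fun u : Fin m → X => Function.Injective (f ∘ u) ∧ ∀ j, f (u j) ∈ s] :
    (Finset.univ.filter fun u : Fin m → X => Function.Injective (f ∘ u) ∧ ∀ j, f (u j) ∈ s).card =
      injectiveWeight m (s.val.map fun i => (Finset.univ.filter fun x => f x = i).card) := by
  classical
  induction m generalizing s with
  | zero =>
    rw [injectiveWeight, Finset.filter_true_of_mem]
    · simp
    · intro u _
      exact ⟨fun i => i.elim0, fun i => i.elim0⟩
  | succ m ih =>
    have hcons : ∀ (a : X) (v : Fin m → X),
        (Function.Injective (f ∘ (Fin.cons a v : Fin (m + 1) → X)) ∧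
          ∀ j, f ((Fin.cons a v : Fin (m + 1) → X) j) ∈ s) ↔
        f a ∈ s ∧ Function.Injective (f ∘ v) ∧ ∀ j, f (v j) ∈ s.erase (f a) := by
      intro a v
      have : f ∘ (Fin.cons a v : Fin (m + 1) → X) = Fin.cons (f a) (f ∘ v) := by
        ext j
        refine Fin.cases ?_ (fun j => ?_) j <;> simp
      rw [this, Fin.cons_injective_iff, Fin.forall_fin_succ]
      simp only [Fin.cons_zero, Fin.cons_succ, Set.mem_range, Function.comp_apply, not_exists,
        Finset.mem_erase, forall_and, ne_eq]
      tauto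
    have hcount : (Finset.univ.filter fun u : Fin (m + 1) → X =>
        Function.Injective (f ∘ u) ∧ ∀ j, f (u j) ∈ s).card =
        ∑ a : X, if f a ∈ s then (Finset.univ.filter fun v : Fin m → X =>
          Function.Injective (f ∘ v) ∧ ∀ j, f (v j) ∈ s.erase (f a)).card else 0 := by
      have h1 : ∀ a : X, (if f a ∈ s then (Finset.univ.filter fun v : Fin m → X =>
          Function.Injective (f ∘ v) ∧ ∀ j, f (v j) ∈ s.erase (f a)).card else 0) =
          ∑ v : Fin m → X, if f a ∈ s ∧ Function.Injective (f ∘ v) ∧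
            ∀ j, f (v j) ∈ s.erase (f a) then 1 else 0 := by
        intro a
        rw [Finset.card_filter]
        split_ifs with h
        · refine Finset.sum_congr rfl fun v _ => if_congr ?_ rfl rfl
          rw [and_iff_right h]
        · exact (Finset.sum_eq_zero fun v _ => if_neg fun h' => h h'.1).symm
      rw [Finset.sum_congr rfl fun a _ => h1 a, Finset.card_filter,
        ← (Fin.consEquiv fun _ => X).sum_comp, Fintype.sum_prod_type]
      refine Finset.sum_congr rfl fun a _ => Finset.sum_congr rfl fun v _ => if_congr ?_ rfl rfl
      exact hcons a v
    rw [hcount, injectiveWeight, Multiset.map_map]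
    simp only [ih]
    rw [← Finset.sum_filter, ← Finset.sum_fiberwise_of_maps_to (g := f) (t := s)
      (fun x hx => (Finset.mem_filter.1 hx).2)]
    refine Finset.sum_congr rfl fun i hi => ?_
    rw [Finset.sum_congr rfl (g := fun _ => injectiveWeight m ((s.erase i).val.map
      fun i => (Finset.univ.filter fun x => f x = i).card))]
    · rw [Finset.sum_const, smul_eq_mul, Finset.filter_filter, Function.comp_apply,
        ← Multiset.map_erase_of_mem (fun i => (Finset.univ.filter fun x => f x = i).card) _
          (show i ∈ s.val from hi), Finset.erase_val]
      congr 2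
      ext x
      simp only [Finset.mem_filter, Finset.mem_univ, true_and]
      exact ⟨fun h => h.2, fun h => ⟨h ▸ hi, h⟩⟩
    · intro x hx
      rw [(Finset.mem_filter.1 hx).2]

/-- The values of `u` lie in pairwise distinct cycles of `σ`. -/
def SeparatesMap {X J : Type*} (σ : Equiv.Perm X) (u : J → X) : Prop :=
  ∀ i j, i ≠ j → ¬ σ.SameCycle (u i) (u j)

theorem IsCycleLabelling.separatesMap_iff {X J ι : Type*} {σ : Equiv.Perm X} {f : X → ι}
    (h : IsCycleLabelling σ f) (u : J → X) :
    SeparatesMap σ u ↔ Function.Injective (f ∘ u) := by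
  simp only [SeparatesMap, h _ _, Function.Injective, Function.comp_apply]
  exact ⟨fun H i j hij => by_contra fun hne => H i j hne hij, fun H i j hne hij => hne (H hij)⟩

theorem SeparatesMap.injective {X J : Type*} {σ : Equiv.Perm X} {u : J → X}
    (h : SeparatesMap σ u) : Function.Injective u := fun i j hij =>
  by_contra fun hne => h i j hne (by rw [hij])

open Classical in
theorem card_filter_separatesMap {X : Type*} [Fintype X] [DecidableEq X] (σ : Equiv.Perm X)
    (m : ℕ) : (Finset.univ.filter fun u : Fin m → X => SeparatesMap σ u).card =
      injectiveWeight m σ.partition.parts := by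
  have : Fintype (Quotient (Equiv.Perm.SameCycle.setoid σ)) := Fintype.ofFinite _
  have h := isCycleLabelling_quotient σ
  rw [h.parts_partition_eq Quotient.mk_surjective, ← card_filter_injective_comp]
  congr 1
  ext u
  simp [h.separatesMap_iff]

theorem separates_iff {n m : ℕ} (hmn : m ≤ n) (σ : Equiv.Perm (Fin n)) :
    Separates m σ ↔ SeparatesMap σ (Fin.castLE hmn) := by
  constructor
  · intro h i j hij
    exact h _ _ i.2 j.2 (by simpa using hij)
  · intro h x y hx hy hxy
    exact h ⟨x, hx⟩ ⟨y, hy⟩ (by simpa [Fin.ext_iff] using hxy)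

theorem exists_perm_comp_eq {X J : Type*} [Finite X] {u v : J → X} (hu : Function.Injective u)
    (hv : Function.Injective v) : ∃ τ : Equiv.Perm X, ∀ j, τ (u j) = v j := by
  classical
  have := Fintype.ofFinite X
  refine ⟨Equiv.extendSubtype ((Equiv.ofInjective u hu).symm.trans (Equiv.ofInjective v hv)),
    fun j => ?_⟩
  rw [Equiv.extendSubtype_apply_of_mem _ _ (Set.mem_range_self j)]
  have : (⟨u j, Set.mem_range_self j⟩ : Set.range u) = Equiv.ofInjective u hu j := rfl
  rw [this, Equiv.trans_apply, Equiv.symm_apply_apply]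
  rfl

theorem SeparatesMap.conj_iff {X J : Type*} (σ τ : Equiv.Perm X) (u : J → X) :
    SeparatesMap (τ * σ * τ⁻¹) (fun j => τ (u j)) ↔ SeparatesMap σ u := by
  simp [SeparatesMap, Equiv.Perm.sameCycle_conj]

open Classical in
theorem numSeparated_eq_card {n : ℕ} (m : ℕ) (lam mu : n.Partition) :
    numSeparated m lam mu =
      ((cycleFactorizations n lam.parts mu.parts).filter fun p => Separates m p.2).card := by
  rw [numSeparated, ← Set.ncard_coe_finset]
  refine Set.ncard_congr (fun p _ => (p.diagonal, p.vertical)) ?_ ?_ ?_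
  · rintro p ⟨h1, h2, h3⟩
    have hp : p.diagonal * p.vertical = p.horizontal := by simp [PlanePermutation.diagonal]
    simp only [Finset.coe_filter, mem_cycleFactorizations, Set.mem_ofPred_eq, hp]
    exact ⟨⟨p.isLongCycle, h1, h2⟩, h3⟩
  · rintro ⟨s, π, hs⟩ ⟨s', π', hs'⟩ _ _ h
    simp only [PlanePermutation.diagonal, Prod.mk.injEq] at h
    obtain ⟨h, rfl⟩ := h
    have := mul_right_cancel h
    subst this
    rfl
  · rintro ⟨α, β⟩ h
    simp only [Finset.coe_filter, mem_cycleFactorizations, Set.mem_ofPred_eq] at h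
    refine ⟨⟨α * β, β, h.1.1⟩, ⟨?_, h.1.2.2, h.2⟩, ?_⟩
    · simpa [HasCycleType, PlanePermutation.diagonal] using h.1.2.1
    · simp [PlanePermutation.diagonal]

/-- Double count pairs (factorization, m-sequence separated by its second factor). Every injective
sequence can be conjugated to (0, …, m-1) and so contributes the same number; a non-injective one
contributes nothing. -/
theorem descFactorial_mul_numSeparated {n m : ℕ} (hmn : m ≤ n) (lam mu : n.Partition) :
    n.descFactorial m * numSeparated m lam mu =
      (cycleFactorizations n lam.parts mu.parts).card * injectiveWeight m mu.parts := by
  classical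
  have h1 : (cycleFactorizations n lam.parts mu.parts).card * injectiveWeight m mu.parts =
      ∑ p ∈ cycleFactorizations n lam.parts mu.parts,
        (Finset.univ.filter fun u : Fin m → Fin n => SeparatesMap p.2 u).card := by
    rw [Finset.sum_congr rfl fun p hp => by
      rw [card_filter_separatesMap, (mem_cycleFactorizations.1 hp).2.2]]
    simp
  have h2 : ∀ u : Fin m → Fin n,
      ((cycleFactorizations n lam.parts mu.parts).filter fun p => SeparatesMap p.2 u).card =
        if Function.Injective u then numSeparated m lam mu else 0 := by
    intro u
    split_ifs with hu
    · obtain ⟨τ, hτ⟩ := exists_perm_comp_eq hu (Fin.castLE_injective hmn)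
      rw [numSeparated_eq_card]
      refine card_filter_cycleFactorizations_conj _ _ (fun β => SeparatesMap β u)
        (fun β => Separates m β) τ fun β => ?_
      rw [separates_iff hmn, ← SeparatesMap.conj_iff β τ u]
      simp only [hτ]
    · rw [Finset.card_eq_zero, Finset.filter_eq_empty_iff]
      exact fun p _ h => hu h.injective
  rw [h1]
  simp only [Finset.card_filter _ Finset.univ]
  rw [Finset.sum_comm]
  simp only [← Finset.card_filter]
  rw [Finset.sum_congr rfl fun u _ => h2 u, ← Finset.sum_filter, Finset.sum_const, smul_eq_mul]
  congr 1
  rw [← Fintype.card_subtype, Fintype.card_congr (Equiv.subtypeInjectiveEquivEmbedding _ _),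
    Fintype.card_embedding_eq, Fintype.card_fin, Fintype.card_fin]

theorem injectiveWeight_eq_zero {m : ℕ} {A : Multiset ℕ} (h : A.card < m) :
    injectiveWeight m A = 0 := by
  induction m generalizing A with
  | zero => omega
  | succ m ih =>
    rw [injectiveWeight]
    refine Multiset.sum_eq_zero fun x hx => ?_
    obtain ⟨r, hr, rfl⟩ := Multiset.mem_map.1 hx
    have := Multiset.card_erase_add_one hr
    rw [ih (by omega), mul_zero]

/-! ### Distinct arrangements of a multiset -/

/-- The sum over the distinct arrangements of `A` of the product of the first `m` entries. -/
def wordSum (m : ℕ) (A : Multiset ℕ) : ℕ := ∑ w ∈ A.lists.toFinset, (w.take m).prod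

theorem mem_words {A : Multiset ℕ} {w : List ℕ} : w ∈ A.lists.toFinset ↔ (w : Multiset ℕ) = A := by
  rw [Multiset.mem_toFinset, Multiset.mem_lists_iff]
  exact eq_comm

theorem sum_words {A : Multiset ℕ} (hA : 0 < A.card) (F : List ℕ → ℕ) :
    ∑ w ∈ A.lists.toFinset, F w =
      ∑ r ∈ A.toFinset, ∑ w ∈ (A.erase r).lists.toFinset, F (r :: w) := by
  rw [Finset.sum_sigma']
  symm
  refine Finset.sum_bij (fun x _ => x.1 :: x.2) ?_ ?_ ?_ ?_
  · rintro ⟨r, w⟩ h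
    rw [Finset.mem_sigma, mem_words, Multiset.mem_toFinset] at h
    have h2 : (w : Multiset ℕ) = A.erase r := h.2
    rw [mem_words, ← Multiset.cons_coe, h2, Multiset.cons_erase h.1]
  · rintro ⟨r, w⟩ _ ⟨r', w'⟩ _ h
    obtain ⟨rfl, rfl⟩ := List.cons.inj h
    rfl
  · intro w hw
    rw [mem_words] at hw
    subst hw
    cases w with
    | nil => simp at hA
    | cons r w => exact ⟨⟨r, w⟩, by simp, rfl⟩
  · intros; rfl

theorem wordSum_succ (m : ℕ) {A : Multiset ℕ} (hA : 0 < A.card) :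
    wordSum (m + 1) A = ∑ r ∈ A.toFinset, r * wordSum m (A.erase r) := by
  rw [wordSum, sum_words hA]
  refine Finset.sum_congr rfl fun r _ => ?_
  rw [wordSum, Finset.mul_sum]
  simp

/-- Passing from distinct values to positions repeats `r` as often as it occurs, which is the factor
by which `countFactorial` drops when one copy of `r` is erased. -/
theorem countFactorial_mul_sum_erase (A : Multiset ℕ) (G : ℕ → Multiset ℕ → ℕ) :
    countFactorial A * ∑ r ∈ A.toFinset, G r (A.erase r) =
      (A.map fun r => countFactorial (A.erase r) * G r (A.erase r)).sum := by
  rw [Finset.sum_multiset_map_count, Finset.mul_sum]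
  refine Finset.sum_congr rfl fun r hr => ?_
  rw [countFactorial_eq_mul_erase (Multiset.mem_toFinset.1 hr), smul_eq_mul, mul_assoc]

theorem countFactorial_mul_wordSum_zero (A : Multiset ℕ) :
    countFactorial A * wordSum 0 A = A.card ! := by
  generalize hd : A.card = d
  induction d generalizing A with
  | zero =>
    rw [Multiset.card_eq_zero] at hd
    subst hd
    have : (0 : Multiset ℕ).lists.toFinset = {[]} := by
      ext w
      rw [mem_words, Multiset.coe_eq_zero, Finset.mem_singleton]
    simp [wordSum, this, countFactorial]
  | succ d ih =>
    rw [wordSum, sum_words (by omega)]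
    have := countFactorial_mul_sum_erase A fun r B => wordSum 0 B
    simp only [wordSum, List.take_zero, List.prod_nil] at this ih ⊢
    rw [this, Multiset.map_congr rfl (g := fun _ => d !)]
    · rw [Multiset.map_const', Multiset.sum_replicate, hd, Nat.factorial_succ, smul_eq_mul]
    · intro r hr
      have := Multiset.card_erase_add_one hr
      exact ih _ (by omega)

/-- Both sides sum the product of the first `m` entries over all orderings of the positions of `A`:
each word comes from `countFactorial A` orderings, and each m-sequence of positions extends to
`(A.card - m)!` of them. -/
theorem countFactorial_mul_wordSum {m : ℕ} {A : Multiset ℕ} (hm : m ≤ A.card) :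
    countFactorial A * wordSum m A = (A.card - m)! * injectiveWeight m A := by
  induction m generalizing A with
  | zero => simp [countFactorial_mul_wordSum_zero, injectiveWeight]
  | succ m ih =>
    rw [wordSum_succ m (by omega), injectiveWeight,
      countFactorial_mul_sum_erase A fun r B => r * wordSum m B, ← Multiset.sum_map_mul_left]
    refine congrArg Multiset.sum (Multiset.map_congr rfl fun r hr => ?_)
    have := Multiset.card_erase_add_one hr
    have h := ih (A := A.erase r) (by omega)
    rw [show A.card - (m + 1) = (A.erase r).card - m by omega, mul_left_comm, h]
    ring

/-! ### Words encoded by their decremented letters and the places of the ones -/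

/-- The list of the decrements of the entries that are larger than `1`. -/
def decrementedList (l : List ℕ) : List ℕ := (l.filter (1 < ·)).map (· - 1)

/-- The multiset of the decrements of the entries that are larger than `1`. -/
def decrementedMultiset (A : Multiset ℕ) : Multiset ℕ := (A.filter (1 < ·)).map (· - 1)

theorem coe_decrementedList (l : List ℕ) :
    (decrementedList l : Multiset ℕ) = decrementedMultiset l := by
  simp [decrementedList, decrementedMultiset]

theorem decrementedMultiset_pos {A : Multiset ℕ} {k : ℕ} (hk : k ∈ decrementedMultiset A) :
    0 < k := by
  simp only [decrementedMultiset, Multiset.mem_map, Multiset.mem_filter] at hk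
  obtain ⟨a, ha, rfl⟩ := hk
  omega

/-- Only the number of ones is lost by decrementing, and the cardinality restores it. -/
theorem eq_of_decrementedMultiset {A : Multiset ℕ} (hA : ∀ k ∈ A, 0 < k) :
    A = Multiset.replicate (A.card - (decrementedMultiset A).card) 1 +
      (decrementedMultiset A).map (· + 1) := by
  have h1 : (decrementedMultiset A).map (· + 1) = A.filter (1 < ·) := by
    rw [decrementedMultiset, Multiset.map_map]
    conv_rhs => rw [← Multiset.map_id (A.filter (1 < ·))]
    refine Multiset.map_congr rfl fun k hk => ?_
    have := (Multiset.mem_filter.1 hk).2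
    simp only [Function.comp_apply, id_eq]
    omega
  have h2 := Multiset.filter_add_not (1 < ·) A
  have h3 : A.filter (fun k => ¬ 1 < k) =
      Multiset.replicate (A.card - (decrementedMultiset A).card) 1 := by
    refine Multiset.eq_replicate.2 ⟨?_, fun k hk => ?_⟩
    · have := congrArg Multiset.card h2
      rw [Multiset.card_add] at this
      rw [decrementedMultiset, Multiset.card_map]
      omega
    · have h4 := hA k (Multiset.mem_of_mem_filter hk)
      have h5 := (Multiset.mem_filter.1 hk).2
      omega
  rw [h1, ← h3, add_comm, h2]

theorem prod_eq_prod_decrementedList {l : List ℕ} (hl : ∀ k ∈ l, 0 < k) :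
    l.prod = ((decrementedList l).map (· + 1)).prod := by
  induction l with
  | nil => rfl
  | cons a l ih =>
    have ha := hl a (by simp)
    have ih := ih fun k hk => hl k (List.mem_cons_of_mem _ hk)
    by_cases h : 1 < a
    · have : a - 1 + 1 = a := by omega
      simp only [decrementedList] at ih ⊢
      simp [h, this, ih]
    · have : a = 1 := by omega
      subst this
      simp only [decrementedList] at ih ⊢
      simpa using ih

/-- The lists of length `k` obtained from the increments of the entries of `L` by inserting
ones. -/
def padded : ℕ → List ℕ → Finset (List ℕ)
  | 0, [] => {[]}
  | 0, _ :: _ => ∅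
  | k + 1, [] => (padded k []).image (1 :: ·)
  | k + 1, a :: L => (padded k (a :: L)).image (1 :: ·) ∪ (padded k L).image ((a + 1) :: ·)

theorem mem_padded {k : ℕ} {L u : List ℕ} (hL : ∀ a ∈ L, 0 < a) :
    u ∈ padded k L ↔ u.length = k ∧ (∀ a ∈ u, 0 < a) ∧ decrementedList u = L := by
  induction k generalizing L u with
  | zero =>
    cases L with
    | nil =>
      simp only [padded, Finset.mem_singleton]
      constructor
      · rintro rfl
        simp [decrementedList]
      · exact fun h => List.length_eq_zero_iff.1 h.1
    | cons a L =>
      simp only [padded, Finset.notMem_empty, false_iff]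
      rintro ⟨h, -, h'⟩
      rw [List.length_eq_zero_iff.1 h] at h'
      simp [decrementedList] at h'
  | succ k ih =>
    have hone : ∀ v, decrementedList (1 :: v) = decrementedList v := fun v => by
      simp [decrementedList]
    have hbig : ∀ b v, 1 < b → decrementedList (b :: v) = (b - 1) :: decrementedList v :=
      fun b v hb => by simp [decrementedList, hb]
    cases u with
    | nil => cases L <;> simp [padded]
    | cons b v =>
      cases L with
      | nil =>
        simp only [padded, Finset.mem_image, ih hL, List.cons.injEq, List.length_cons,
          List.mem_cons, forall_eq_or_imp, Nat.add_right_cancel_iff]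
        constructor
        · rintro ⟨w, ⟨h1, h2, h3⟩, rfl, rfl⟩
          exact ⟨h1, ⟨one_pos, h2⟩, by rw [hone, h3]⟩
        · rintro ⟨h1, ⟨h2, h3⟩, h4⟩
          have hb : b = 1 := by
            by_contra hb
            rw [hbig b v (by omega)] at h4
            simp at h4
          subst hb
          exact ⟨v, ⟨h1, h3, by rw [← hone, h4]⟩, rfl, rfl⟩
      | cons a L =>
        have hL' : ∀ a ∈ L, 0 < a := fun x hx => hL x (List.mem_cons_of_mem _ hx)
        have ha := hL a (by simp)
        simp only [padded, Finset.mem_union, Finset.mem_image, ih hL, ih hL', List.cons.injEq,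
          List.length_cons, List.mem_cons, forall_eq_or_imp, Nat.add_right_cancel_iff]
        constructor
        · rintro (⟨w, ⟨h1, h2, h3⟩, rfl, rfl⟩ | ⟨w, ⟨h1, h2, h3⟩, rfl, rfl⟩)
          · exact ⟨h1, ⟨one_pos, h2⟩, by rw [hone, h3]⟩
          · exact ⟨h1, ⟨by omega, h2⟩, by rw [hbig _ _ (by omega), h3, Nat.add_sub_cancel]⟩
        · rintro ⟨h1, ⟨h2, h3⟩, h4⟩
          by_cases hb : b = 1
          · subst hb
            exact Or.inl ⟨v, ⟨h1, h3, by rw [← hone, h4]⟩, rfl, rfl⟩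
          · rw [hbig b v (by omega), List.cons.injEq] at h4
            exact Or.inr ⟨v, ⟨h1, h3, h4.2⟩, by omega, rfl⟩

/-- Pascal's rule, according to whether the first letter is 1; positivity of the entries of `L`
keeps the two cases disjoint. -/
theorem card_padded {k : ℕ} {L : List ℕ} (hL : ∀ a ∈ L, 0 < a) :
    (padded k L).card = k.choose L.length := by
  induction k generalizing L with
  | zero => cases L <;> simp [padded]
  | succ k ih =>
    have hinj : ∀ a : ℕ, Function.Injective (a :: · : List ℕ → List ℕ) :=
      fun a => List.cons_injective
    cases L with
    | nil => rw [padded, Finset.card_image_of_injective _ (hinj 1), ih hL]; simp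
    | cons a L =>
      have ha := hL a (by simp)
      rw [padded, Finset.card_union_of_disjoint, Finset.card_image_of_injective _ (hinj 1),
        Finset.card_image_of_injective _ (hinj _), ih hL,
        ih fun x hx => hL x (List.mem_cons_of_mem _ hx), List.length_cons, Nat.choose_succ_succ,
        add_comm]
      rw [Finset.disjoint_left]
      intro u hu hu'
      obtain ⟨v, -, rfl⟩ := Finset.mem_image.1 hu
      obtain ⟨v', -, h⟩ := Finset.mem_image.1 hu'
      have := (List.cons.inj h).1
      omega

/-- The pairs of lists whose concatenation is an arrangement of `D`. -/
def splitWords (D : Multiset ℕ) : Finset (List ℕ × List ℕ) :=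
  (D.lists.toFinset ×ˢ Finset.range (D.card + 1)).image fun x => (x.1.take x.2, x.1.drop x.2)

theorem mem_splitWords {D : Multiset ℕ} {x : List ℕ × List ℕ} :
    x ∈ splitWords D ↔ (x.1 : Multiset ℕ) + (x.2 : Multiset ℕ) = D := by
  obtain ⟨u, v⟩ := x
  simp only [splitWords, Finset.mem_image, Finset.mem_product, mem_words, Finset.mem_range,
    Prod.mk.injEq, Prod.exists, Multiset.coe_add]
  constructor
  · rintro ⟨w, i, ⟨h, -⟩, rfl, rfl⟩
    rw [List.take_append_drop, h]
  · intro h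
    refine ⟨u ++ v, u.length, ⟨h, ?_⟩, by simp, by simp⟩
    rw [← h]
    simp

/-- Cut each word after `k` letters and group by the decremented lists of the two pieces. A group is
a product of two sets of padded lists, and the weight is constant on it because ones do not affect
the product. -/
theorem wordSum_eq_sum_splitWords {k : ℕ} {A : Multiset ℕ} (hA : ∀ a ∈ A, 0 < a)
    (hk : k ≤ A.card) :
    wordSum k A = ∑ x ∈ splitWords (decrementedMultiset A),
      (A.card - k).choose x.2.length * (k.choose x.1.length * (x.1.map (· + 1)).prod) := by
  have hadd : ∀ B C, decrementedMultiset (B + C) = decrementedMultiset B + decrementedMultiset C :=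
    fun B C => by simp [decrementedMultiset]
  rw [wordSum, ← Finset.sum_fiberwise_of_maps_to
    (g := fun w : List ℕ => (decrementedList (w.take k), decrementedList (w.drop k)))
    (t := splitWords (decrementedMultiset A))
    (fun w hw => by
      rw [mem_splitWords, coe_decrementedList, coe_decrementedList, ← hadd, Multiset.coe_add,
        List.take_append_drop, mem_words.1 hw])]
  refine Finset.sum_congr rfl ?_
  rintro ⟨rs, qs⟩ hx
  rw [mem_splitWords] at hx
  have hpos : ∀ a ∈ rs ++ qs, 0 < a := fun a ha => decrementedMultiset_pos (A := A) (by
    rw [← hx, Multiset.coe_add]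
    exact ha)
  have hrs : ∀ a ∈ rs, 0 < a := fun a ha => hpos a (List.mem_append_left _ ha)
  have hqs : ∀ a ∈ qs, 0 < a := fun a ha => hpos a (List.mem_append_right _ ha)
  rw [Finset.sum_congr rfl (g := fun _ => (rs.map (· + 1)).prod), Finset.sum_const, smul_eq_mul,
    ← card_padded hqs, ← card_padded hrs, ← mul_assoc,
    mul_comm (Finset.card (padded _ qs)), ← Finset.card_product]
  · congr 1
    refine Finset.card_bij' (fun w _ => (w.take k, w.drop k)) (fun x _ => x.1 ++ x.2) ?_ ?_ ?_ ?_
    · intro w hw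
      simp only [Finset.mem_filter, mem_words, Prod.mk.injEq] at hw
      obtain ⟨hw, h1, h2⟩ := hw
      have hlen : w.length = A.card := by rw [← hw]; rfl
      rw [Finset.mem_product, mem_padded hrs, mem_padded hqs]
      subst hw
      refine ⟨⟨by simpa using hk, fun a ha => hA a ?_, h1⟩,
        by simp, fun a ha => hA a ?_, h2⟩
      · exact List.mem_of_mem_take ha
      · exact List.mem_of_mem_drop ha
    · rintro ⟨u, v⟩ h
      rw [Finset.mem_product, mem_padded hrs, mem_padded hqs] at h
      obtain ⟨⟨hu1, hu2, hu3⟩, hv1, hv2, hv3⟩ := h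
      dsimp only at hu1 hu2 hu3 hv1 hv2 hv3
      simp only [Finset.mem_filter, mem_words, Prod.mk.injEq]
      refine ⟨?_, ?_, ?_⟩
      -- The glued word is an arrangement of `A` because its length and its decremented multiset are
      -- those of `A`.
      · have hdec : decrementedMultiset ((u ++ v : List ℕ) : Multiset ℕ) =
            decrementedMultiset A := by
          rw [← Multiset.coe_add, hadd, ← coe_decrementedList, ← coe_decrementedList, hu3, hv3, hx]
        rw [eq_of_decrementedMultiset hA, eq_of_decrementedMultiset
          (A := ((u ++ v : List ℕ) : Multiset ℕ)), hdec]
        · congr 3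
          simp
          omega
        · intro a ha
          rcases List.mem_append.1 ha with ha | ha
          · exact hu2 a ha
          · exact hv2 a ha
      · rw [List.take_left' hu1, hu3]
      · rw [List.drop_left' hu1, hv3]
    · intro w _
      exact List.take_append_drop _ _
    · rintro ⟨u, v⟩ h
      rw [Finset.mem_product, mem_padded hrs] at h
      have hu1 : u.length = k := h.1.1
      simp only [List.take_left' hu1, List.drop_left' hu1]
  · intro w hw
    simp only [Finset.mem_filter, mem_words, Prod.mk.injEq] at hw
    obtain ⟨hw, h1, -⟩ := hw
    rw [prod_eq_prod_decrementedList, h1]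
    intro a ha
    refine hA a ?_
    rw [← hw]
    exact List.mem_of_mem_take ha

/-! ### The index set of the formula and the final assembly -/

theorem decrementedMultiset_cons_sub {r : ℕ} (hr : 0 < r) (A : Multiset ℕ) :
    decrementedMultiset (r ::ₘ A) - {r - 1} = decrementedMultiset A := by
  rw [Multiset.sub_singleton]
  by_cases h : 1 < r
  · rw [decrementedMultiset, Multiset.filter_cons_of_pos _ h, Multiset.map_cons,
      Multiset.erase_cons_head]
    rfl
  · obtain rfl : r = 1 := by omega
    rw [decrementedMultiset, Multiset.filter_cons_of_neg _ h]
    exact Multiset.erase_of_notMem fun h0 => lt_irrefl _ (decrementedMultiset_pos h0)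

theorem card_decrementedMultiset_add_deltaBar {r : ℕ} (hr : 0 < r) (A : Multiset ℕ) :
    (decrementedMultiset A).card + deltaBar r = ((r ::ₘ A).filter (1 < ·)).card := by
  rw [decrementedMultiset, Multiset.card_map, deltaBar]
  by_cases h : 1 < r
  · rw [Multiset.filter_cons_of_pos _ h, if_neg (by omega), Multiset.card_cons]
  · rw [Multiset.filter_cons_of_neg _ h, if_pos (by omega), add_zero]

/-- The length condition on the tuples follows from the multiset equation by taking cardinalities,
so only the latter remains. -/
theorem mem_tupleIndexSet_iff {n : ℕ} (mu : n.Partition) (r : ℕ) (rs qs : List ℕ) :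
    (r, rs, qs) ∈ tupleIndexSet mu ↔
      r ∈ mu.parts ∧ (rs, qs) ∈ splitWords (decrementedMultiset (mu.parts.erase r)) := by
  rw [mem_splitWords]
  by_cases hr : r ∈ mu.parts
  · have hr0 : 0 < r := mu.parts_pos hr
    have h1 : decrementedParts mu - {r - 1} = decrementedMultiset (mu.parts.erase r) := by
      rw [← decrementedMultiset_cons_sub hr0, Multiset.cons_erase hr]
      rfl
    have h2 := card_decrementedMultiset_add_deltaBar hr0 (mu.parts.erase r)
    rw [Multiset.cons_erase hr] at h2
    simp only [tupleIndexSet, Set.mem_ofPred_eq, hr, hr0, true_and, h1, add_assoc,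
      add_right_inj]
    constructor
    · exact fun h => h.2
    · intro h
      refine ⟨?_, h⟩
      rw [numBigParts, ← h2, ← h, ← add_assoc]
      simp
  · simp [tupleIndexSet, hr]

/-- The component `r` is the first letter of the word; the two tuples encode the rest, cut after its
first `m - 1` letters. -/
theorem sum_tupleIndexSet_eq_wordSum {n m : ℕ} (mu : n.Partition) (hm : 1 ≤ m)
    (hmd : m ≤ mu.parts.card) :
    ∑ x ∈ (tupleIndexSet_finite mu).toFinset,
      (mu.parts.card - m).choose (numBigParts mu - x.2.1.length - deltaBar x.1) *
        ((m - 1).choose x.2.1.length * x.1 * (x.2.1.map (· + 1)).prod) =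
      wordSum m mu.parts := by
  obtain ⟨k, rfl⟩ := Nat.exists_eq_add_of_le' hm
  have hset : (tupleIndexSet_finite mu).toFinset = (mu.parts.toFinset.sigma fun r =>
      splitWords (decrementedMultiset (mu.parts.erase r))).image fun x => (x.1, x.2) := by
    ext ⟨r, rs, qs⟩
    rw [Set.Finite.mem_toFinset, mem_tupleIndexSet_iff]
    simp
  rw [hset, Finset.sum_image, Finset.sum_sigma, wordSum_succ k (by omega)]
  · refine Finset.sum_congr rfl fun r hr => ?_
    rw [Multiset.mem_toFinset] at hr
    have hcard := Multiset.card_erase_add_one hr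
    rw [wordSum_eq_sum_splitWords (fun a ha => mu.parts_pos (Multiset.mem_of_mem_erase ha))
      (by omega), Finset.mul_sum]
    refine Finset.sum_congr rfl fun x hx => ?_
    rw [mem_splitWords] at hx
    have h2 := card_decrementedMultiset_add_deltaBar (mu.parts_pos hr) (mu.parts.erase r)
    rw [Multiset.cons_erase hr, ← hx, Multiset.card_add, Multiset.coe_card,
      Multiset.coe_card] at h2
    have h3 : numBigParts mu - x.1.length - deltaBar r = x.2.length := by
      rw [numBigParts]
      omega
    dsimp only
    rw [h3, show mu.parts.card - (k + 1) = (mu.parts.erase r).card - k by omega,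
      Nat.add_sub_cancel]
    ring
  · rintro ⟨r, x⟩ _ ⟨r', x'⟩ _ h
    simp only [Prod.mk.injEq] at h
    obtain ⟨rfl, rfl⟩ := h
    rfl

/-- A division-free form of the formula: the falling factorial cancels against `n !` and leaves `(n
- m)!`, and the multiplicity factorials of `mu` cancel against those in
`countFactorial_mul_wordSum`. -/
theorem numSeparated_mul_eq {n m : ℕ} (lam mu : n.Partition) (hn : 0 < n) (hmn : m ≤ n)
    (hc : mu.parts.card + lam.parts.card = n + 1) (hmd : m ≤ mu.parts.card) :
    numSeparated m lam mu * (countFactorial lam.parts * (mu.parts.card - m)!) =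
      ((lam.parts.card - 1)! * (mu.parts.card - 1)! * (n - m)!) * wordSum m mu.parts := by
  have h1 := descFactorial_mul_numSeparated hmn lam mu
  have h2 := card_cycleFactorizations hn lam.parts mu.parts (fun _ h => lam.parts_pos h)
    (fun _ h => mu.parts_pos h) lam.parts_sum mu.parts_sum (by omega)
  have h3 := countFactorial_mul_wordSum hmd
  have h4 := Nat.factorial_mul_descFactorial hmn
  have hpos : 0 < n.descFactorial m * countFactorial mu.parts :=
    Nat.mul_pos (Nat.descFactorial_pos.2 hmn) (countFactorial_pos _)
  refine Nat.eq_of_mul_eq_mul_left hpos ?_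
  calc _ = (n.descFactorial m * numSeparated m lam mu) *
        (countFactorial lam.parts * countFactorial mu.parts) * (mu.parts.card - m)! := by ring
    _ = ((cycleFactorizations n lam.parts mu.parts).card *
        (countFactorial lam.parts * countFactorial mu.parts)) *
          ((mu.parts.card - m)! * injectiveWeight m mu.parts) := by rw [h1]; ring
    _ = _ := by rw [h2, ← h3, ← h4]; ring

theorem mainTheorem9 (n m d t : ℕ) (lam mu : n.Partition)
    (hd : numParts mu = d) (ht : numParts lam = t) (hdt : d + t = n + 1)
    (hm : 1 ≤ m) (hmn : m ≤ n) :
    (m ≤ d →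
      (numSeparated m lam mu : ℚ) =
        (((t - 1)! * (d - 1)! * (n - m)! : ℕ) : ℚ) /
            (((∏ i ∈ Finset.Icc 1 n, (lam.parts.count i)!) * (d - m)! : ℕ) : ℚ) *
          ∑ x ∈ (tupleIndexSet_finite mu).toFinset,
            (((d - m).choose (numBigParts mu - x.2.1.length - deltaBar x.1) *
              ((m - 1).choose x.2.1.length * x.1 *
                (x.2.1.map (· + 1)).prod) : ℕ) : ℚ)) ∧
    (d < m → numSeparated m lam mu = 0) := by
  subst hd ht
  constructor
  · intro hmd
    have hfac : ∏ i ∈ Finset.Icc 1 n, (lam.parts.count i)! = countFactorial lam.parts := by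
      refine (countFactorial_eq_prod fun i hi => ?_).symm
      rw [Multiset.mem_toFinset] at hi
      exact Finset.mem_Icc.2 ⟨lam.parts_pos hi, lam.parts_sum ▸ Multiset.le_sum_of_mem hi⟩
    rw [hfac, ← Nat.cast_sum]
    have h1 := sum_tupleIndexSet_eq_wordSum mu hm hmd
    have h2 := numSeparated_mul_eq lam mu (by omega) hmn hdt hmd
    simp only [numParts] at hmd ⊢
    rw [h1, div_mul_eq_mul_div, eq_div_iff]
    · exact_mod_cast h2
    · exact_mod_cast (Nat.mul_pos (countFactorial_pos _) (Nat.factorial_pos _)).ne'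
  · intro h
    -- With fewer than `m` cycles no m-sequence is separated, while the falling factorial is
    -- nonzero.
    have h1 := descFactorial_mul_numSeparated hmn lam mu
    rw [injectiveWeight_eq_zero h, mul_zero] at h1
    exact (Nat.mul_eq_zero.1 h1).resolve_left (Nat.descFactorial_pos.2 hmn).ne'
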